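/- Let $k\ge 1$ and let $(X,\mathbf Y)$, with $X$ scalar and $\mathbf Y=(Y_1,\dots,Y_k)$, have under the prior the Gaussian law $\mathcal N_{k+1}(\mu,\Sigma)$ with density $f$, where $\mu=(\mu_x,\mu_{\mathbf y})$ and $$\Sigma=\begin{pmatrix}\sigma_{xx}&\sigma_{x\mathbf y}^T\\ \sigma_{x\mathbf y}&\Sigma_{\mathbf{yy}}\end{pmatrix}$$ is positive definite, $\sigma_{x\mathbf y}=(\sigma_{xy_1},\dots,\sigma_{xy_k})^T$, $\sigma_{xy_i}=\mathrm{Cov}(X,Y_i)$. Let $\mathbf a\in\mathbb R^k$ and let $g$ be a probability density on $\mathbb R$ with finite first moment $E_g(X)=\int xg(x)\,dx$. Assume that there is $\alpha>1$ such that $\lim_{t\to\infty}g(\eta t)/g(t)=\eta^{-\alpha}$ for every $\eta>0$, and that for all $c\in\mathbb R$, $b>0$ there is a function $h\ge 0$ with $E\,h(Z)<\infty$ for every Gaussian random variable $Z$, such that for all sufficiently large $t$ $$\frac{g(b(t-s-c))}{g(t)}\le h(s)\quad\text{for all } s\in\mathbb R .$$ Let $\tilde f(x,\mathbf y)=g(x)\,\tilde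 f(\mathbf y|x)$, where $\tilde f(\cdot|x)$ is the density of $$\mathcal N_k\Big(\mathbf a+\frac{x-E_g(X)}{\sigma_{xx}}\,\sigma_{x\mathbf y},\ \Sigma_{\mathbf{yy}}-\frac1{\sigma_{xx}}\sigma_{x\mathbf y}\sigma_{x\mathbf y}^T\Big),$$ and for each $i$ let $\tilde f_{Y_i}$ be the marginal density of $Y_i$ under $\tilde f$, obtained by integrating $\tilde f$ over $x$ and all $y_j$, $j\ne i$. Then: (a) $\tilde f$ is the posterior for the view "$X$ has density $g$ and $\tilde E(\mathbf Y)=\mathbf a$": it satisfies the view and minimizes the relative entropy $\int\log(\nu/f)\,\nu\in[0,\infty]$ among all probability laws $\nu\ll f$ on $\mathbb R\times\mathbb R^k$ under which $X$ has density $g$ and $\mathbf Y$ is integrable with mean $\mathbf a$. (b) For every $i$ (in particular for $i=1$) with $\sigma_{xy_i}\neq0$, $Y_i$ inherits the tail of $X$: - if $\sigma_{xy_i}>0$, then $\displaystyle\lim_{s\to\infty}\frac{\tilde f_{Y_i}(s)}{g(s)}=\Big(\frac{\sigma_{xy_i}}{\sigma_{xx}}\Big)^{\alpha-1}$; - if $\sigma_{xy_i}<0$,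 then $\displaystyle\lim_{s\to\infty}\frac{\tilde f_{Y_i}(-s)}{g(s)}=\Big(\frac{|\sigma_{xy_i}|}{\sigma_{xx}}\Big)^{\alpha-1}$; - if $\sigma_{xy_i}\ne0$ and $g$ is even, then $\displaystyle\lim_{s\to\infty}\frac{\tilde f_{Y_i}(s)}{g(s)}=\Big(\frac{|\sigma_{xy_i}|}{\sigma_{xx}}\Big)^{\alpha-1}$. -/

import Mathlib

open MeasureTheory ProbabilityTheory Filter Topology

noncomputable section

/-- The density of the nondegenerate Gaussian law `N(m, S)` on `ι → ℝ` (for `S` positive definite)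
with respect to Lebesgue measure. -/
def gaussianDensity {ι : Type} [Fintype ι] [DecidableEq ι] (m : ι → ℝ) (S : Matrix ι ι ℝ)
    (y : ι → ℝ) : ℝ :=
  (Real.sqrt ((2 * Real.pi) ^ Fintype.card ι * S.det))⁻¹ *
    Real.exp (-(1 / 2) * ((y - m) ⬝ᵥ (S⁻¹.mulVec (y - m))))

/-- The covariance matrix of `(X, Y)`, with `X` scalar and `Y = (Y_1, …, Y_k)`, assembled from
`σxx = Var X`, `σxy j = Cov(X, Y_j)` and `Syy = Cov Y`. -/
def jointCov {k : ℕ} (σxx : ℝ) (σxy : Fin k → ℝ) (Syy : Matrix (Fin k) (Fin k) ℝ) :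
    Matrix (Unit ⊕ Fin k) (Unit ⊕ Fin k) ℝ :=
  Matrix.fromBlocks (Matrix.of fun _ _ => σxx) (Matrix.of fun _ j => σxy j)
    (Matrix.of fun j _ => σxy j) Syy

/-- The joint density `f(x, y)` of `(X, Y)` under the Gaussian prior. -/
def priorDensity {k : ℕ} (μx : ℝ) (μy : Fin k → ℝ) (σxx : ℝ) (σxy : Fin k → ℝ)
    (Syy : Matrix (Fin k) (Fin k) ℝ) (p : ℝ × (Fin k → ℝ)) : ℝ :=
  gaussianDensity (Sum.elim (fun _ : Unit => μx) μy) (jointCov σxx σxy Syy)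
    (Sum.elim (fun _ : Unit => p.1) p.2)

/-- The measure on `ℝ × ℝ^k` with Lebesgue density `f`. -/
def jointLaw {k : ℕ} (f : ℝ × (Fin k → ℝ) → ℝ) : Measure (ℝ × (Fin k → ℝ)) :=
  volume.withDensity fun p => ENNReal.ofReal (f p)

/-- `g` is a probability density function on `ℝ`. -/
structure IsProbDensity (g : ℝ → ℝ) : Prop where
  measurable : Measurable g
  nonneg : ∀ x, 0 ≤ g x
  integral_eq_one : ∫ x, g x = 1

/-- The expectation of `X` under the density `g`. -/
def meanOf (g : ℝ → ℝ) : ℝ := ∫ x, x * g x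

/-- `ν` is a law of `(X, Y)`, absolutely continuous with respect to the prior `P`, which satisfies
the view: `X` has density `g`, and `E[Y] = a`. -/
structure SatisfiesView {k : ℕ} (P : Measure (ℝ × (Fin k → ℝ))) (g : ℝ → ℝ) (a : Fin k → ℝ)
    (ν : Measure (ℝ × (Fin k → ℝ))) : Prop where
  isProbabilityMeasure : IsProbabilityMeasure ν
  absolutelyContinuous : ν ≪ P
  marginal : ν.map Prod.fst = volume.withDensity fun x => ENNReal.ofReal (g x)
  integrable : ∀ j, Integrable (fun p => p.2 j) ν
  mean : ∀ j, ∫ p, p.2 j ∂ν = a j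

/-- `ν` minimizes the relative entropy (I-divergence) with respect to the prior `P` among all laws
that satisfy the view. -/
def IsOptimalPosterior {k : ℕ} (P : Measure (ℝ × (Fin k → ℝ))) (g : ℝ → ℝ) (a : Fin k → ℝ)
    (ν : Measure (ℝ × (Fin k → ℝ))) : Prop :=
  SatisfiesView P g a ν ∧
    ∀ ν', SatisfiesView P g a ν' → InformationTheory.klDiv ν P ≤ InformationTheory.klDiv ν' P

/-- The posterior density `f̃(x, y) = g(x) f̃(y | x)`, where `f̃(· | x)` is the density of
`N(a + ((x - E_g X) / σxx) σxy, Syy - (1 / σxx) σxy σxyᵀ)`. -/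
def posteriorDensity {k : ℕ} (g : ℝ → ℝ) (a : Fin k → ℝ) (σxx : ℝ) (σxy : Fin k → ℝ)
    (Syy : Matrix (Fin k) (Fin k) ℝ) (p : ℝ × (Fin k → ℝ)) : ℝ :=
  g p.1 * gaussianDensity (a + ((p.1 - meanOf g) / σxx) • σxy)
    (Syy - (1 / σxx) • Matrix.vecMulVec σxy σxy) p.2

/-- The marginal density of `Y_i` when `(X, Y)` has joint density `f`: the integral of `f` over `x`
and over all `y_j`, `j ≠ i`, with `y_i = s`. -/
def marginalDensityY {k : ℕ} (f : ℝ × (Fin k → ℝ) → ℝ) (i : Fin k) (s : ℝ) : ℝ :=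
  ∫ q : ℝ × ({j : Fin k // j ≠ i} → ℝ),
    f (q.1, fun j => if h : j = i then s else q.2 ⟨j, h⟩)

/-- `g` is regularly varying at `+∞` with index `α > 1`, and the ratios `g(b(t-s-c)) / g(t)` are
dominated, for all large `t`, by a function of `s` with finite Gaussian expectations. -/
structure FatTailed (g : ℝ → ℝ) (α : ℝ) : Prop where
  one_lt : 1 < α
  regularlyVarying : ∀ η : ℝ, 0 < η → Tendsto (fun t => g (η * t) / g t) atTop (𝓝 (1 / η ^ α))
  dominated : ∀ c b : ℝ, 0 < b → ∃ h : ℝ → ℝ, (∀ s, 0 ≤ h s) ∧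
    (∀ (m : ℝ) (v : NNReal), Integrable h (gaussianReal m v)) ∧
    ∀ᶠ t in atTop, ∀ s, g (b * (t - s - c)) / g t ≤ h s

end

/-! Optimality. Given `X = x`, prior and posterior are Gaussian with the same covariance `T` (the
Schur complement of `σxx`), and their means differ by a vector `d` independent of `x`, since both
depend on `x` with slope `σxy / σxx`. The quadratic terms in `y` therefore cancel in the density
ratio `r`, and `log r = L(x) + y ⬝ᵥ T⁻¹ d` wherever `r > 0`. The view fixes the law of `X` and the
mean of `Y`, hence the integral of `log r`. Gibbs' inequality bounds this integral by the entropy of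
any competitor, with equality at the posterior (`klDiv_withDensity_le`). The delicate point is that
`L(X)` is not assumed integrable: this is extracted from a competitor of finite entropy.

Tails. Integrating out the other coordinates writes the density of `Y_i` as `∫ g(x) φ_v(t - c - ρx)
dx = ρ⁻¹ E g(ρ⁻¹(t - U - c))`, with `U` a centred Gaussian of variance `v` and `ρ = σxy i / σxx >
0`. After division by `g t` the integrand tends to `ρ ^ α`, and the dominating function `h` lets the
limit pass under the expectation (`FatTailed.tendsto_gaussian_mixture_div`). The pointwise limit
needs `g (t - d) / g t → 1`, which comes from local uniformity of slow variation
(`tendsto_add_sub_of_measurable`). Reflections reduce the other signs to `ρ > 0`. -/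

lemma mul_log_le_mul_log_sub_add {a r : ℝ} (ha : 0 ≤ a) (hr : 0 ≤ r) (h : a ≠ 0 → 0 < r) :
    a * Real.log r ≤ a * Real.log a - a + r := by
  rcases ha.eq_or_lt with rfl | ha'
  · simpa using hr
  · have hr' := h ha'.ne'
    have h1 := Real.log_le_sub_one_of_pos (div_pos hr' ha')
    rw [Real.log_div hr'.ne' ha'.ne'] at h1
    have h2 := mul_le_mul_of_nonneg_left h1 ha
    have h3 : a * (r / a - 1) = r - a := by field_simp
    linarith

/-! ### Relative entropy and Gibbs' inequality. -/

section Entropy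

variable {Ω : Type*} [MeasurableSpace Ω] {P ν : Measure Ω} [IsProbabilityMeasure P]
  [IsProbabilityMeasure ν]

/-- Gibbs' variational inequality, pointwise form. -/
lemma ae_rnDeriv_mul_log_le (hac : ν ≪ P) {r : Ω → ℝ} (hr : ∀ x, 0 ≤ r x)
    (hpos : ∀ᵐ x ∂ν, 0 < r x) :
    ∀ᵐ x ∂P, (ν.rnDeriv P x).toReal * Real.log (r x) ≤
      (ν.rnDeriv P x).toReal * Real.log (ν.rnDeriv P x).toReal - (ν.rnDeriv P x).toReal + r x := by
  rw [← Measure.withDensity_rnDeriv_eq ν P hac,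
    ae_withDensity_iff (Measure.measurable_rnDeriv ν P)] at hpos
  filter_upwards [hpos] with x hx
  refine mul_log_le_mul_log_sub_add ENNReal.toReal_nonneg (hr x) fun h => hx fun h0 => h ?_
  simp [h0]

lemma integrable_rnDeriv_mul_log_sub_add (hac : ν ≪ P) (hllr : Integrable (llr ν P) ν) {r : Ω → ℝ}
    (hr : Integrable r P) : Integrable (fun x => (ν.rnDeriv P x).toReal *
      Real.log (ν.rnDeriv P x).toReal - (ν.rnDeriv P x).toReal + r x) P :=
  (((integrable_rnDeriv_mul_log_iff hac).2 hllr).sub Measure.integrable_toReal_rnDeriv).add hr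

/-- The pointwise Gibbs inequality for `max r 1` needs no normalization, and its left side is
nonnegative, so its integrable right side dominates. This controls the positive part of `log r`
under every law of finite entropy. -/
lemma integrable_log_max_one (hac : ν ≪ P) (hllr : Integrable (llr ν P) ν) {r : Ω → ℝ}
    (hm : Measurable r) (hr : Integrable r P) :
    Integrable (fun x => Real.log (max (r x) 1)) ν := by
  rw [← integrable_rnDeriv_smul_iff hac]
  have hpos : ∀ x, 0 < max (r x) 1 := fun x => lt_max_of_lt_right one_pos
  refine (integrable_rnDeriv_mul_log_sub_add hac hllr (hr.sup (integrable_const 1))).mono' ?_ ?_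
  · exact Measurable.aestronglyMeasurable (by fun_prop)
  · filter_upwards [ae_rnDeriv_mul_log_le hac (fun x => (hpos x).le) (ae_of_all _ hpos)] with x hx
    rw [smul_eq_mul, Real.norm_of_nonneg
      (mul_nonneg ENNReal.toReal_nonneg (Real.log_nonneg (le_max_right _ _)))]
    exact hx

lemma integral_log_le_integral_llr (hac : ν ≪ P) (hllr : Integrable (llr ν P) ν) {r : Ω → ℝ}
    (hr0 : ∀ x, 0 ≤ r x) (hr : Integrable r P) (hr1 : ∫ x, r x ∂P = 1)
    (hpos : ∀ᵐ x ∂ν, 0 < r x) (hlog : Integrable (fun x => Real.log (r x)) ν) :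
    ∫ x, Real.log (r x) ∂ν ≤ ∫ x, llr ν P x ∂ν := by
  have h1 := integral_mono_ae ((integrable_rnDeriv_smul_iff hac).2 hlog)
    (integrable_rnDeriv_mul_log_sub_add hac hllr hr) (ae_rnDeriv_mul_log_le hac hr0 hpos)
  rw [integral_rnDeriv_smul hac] at h1
  have h2 : Integrable (fun x => (ν.rnDeriv P x).toReal * Real.log (ν.rnDeriv P x).toReal) P :=
    (integrable_rnDeriv_mul_log_iff hac).2 hllr
  have h3 : Integrable (fun x => (ν.rnDeriv P x).toReal) P := Measure.integrable_toReal_rnDeriv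
  have h5 := integral_add (h2.sub h3) hr
  simp only [Pi.sub_apply] at h5
  rw [h5, integral_sub h2 h3, hr1, Measure.integral_toReal_rnDeriv hac] at h1
  have h4 : ∫ x, (ν.rnDeriv P x).toReal * Real.log (ν.rnDeriv P x).toReal ∂P =
      ∫ x, llr ν P x ∂ν := integral_rnDeriv_smul hac (f := llr ν P)
  simp only [probReal_univ] at h1
  linarith

/-- If the log-density of `P.withDensity r` is the sum of a function of `π` and of a function `A`,
then `P.withDensity r` minimizes the relative entropy to `P` among the laws under which `π` has the
same distribution and `A` the same mean. -/
theorem klDiv_withDensity_le {β : Type*} [MeasurableSpace β] {r : Ω → ℝ} (hrm : Measurable r)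
    (hr0 : ∀ x, 0 ≤ r x) {ν₀ : Measure Ω} [IsProbabilityMeasure ν₀]
    (hν₀ : ν₀ = P.withDensity fun x => ENNReal.ofReal (r x)) (hac : ν ≪ P)
    (hpos : ∀ᵐ x ∂ν, 0 < r x) {π : Ω → β} (hπ : Measurable π) {L : β → ℝ} (hL : Measurable L)
    {A : Ω → ℝ} (hlog : ∀ x, 0 < r x → Real.log (r x) = L (π x) + A x)
    (hA : Integrable A ν) (hA₀ : Integrable A ν₀) (hAeq : ∫ x, A x ∂ν = ∫ x, A x ∂ν₀)
    (hmap : ν.map π = ν₀.map π) :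
    InformationTheory.klDiv ν₀ P ≤ InformationTheory.klDiv ν P := by
  by_cases htop : InformationTheory.klDiv ν P = ⊤
  · simp [htop]
  obtain ⟨-, hllr⟩ := InformationTheory.klDiv_ne_top_iff.1 htop
  have transfer : ∀ {f : β → ℝ}, Measurable f →
      (Integrable (fun x => f (π x)) ν ↔ Integrable (fun x => f (π x)) ν₀) := by
    intro f hf
    have h1 := integrable_map_measure (μ := ν) hf.aestronglyMeasurable hπ.aemeasurable
    have h2 := integrable_map_measure (μ := ν₀) hf.aestronglyMeasurable hπ.aemeasurable
    rw [hmap] at h1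
    exact h1.symm.trans h2
  have hrm' : Measurable fun x => ENNReal.ofReal (r x) := hrm.ennreal_ofReal
  have hpos₀ : ∀ᵐ x ∂ν₀, 0 < r x := by
    rw [hν₀, ae_withDensity_iff hrm']
    exact ae_of_all _ fun x hx => by simpa using hx
  have hlint : ∫⁻ x, ENNReal.ofReal (r x) ∂P = 1 := by
    have := measure_univ (μ := ν₀)
    rwa [hν₀, withDensity_apply _ MeasurableSet.univ, Measure.restrict_univ] at this
  have hrint : Integrable r P :=
    (lintegral_ofReal_ne_top_iff_integrable hrm.aestronglyMeasurable (ae_of_all _ hr0)).1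
      (by simp [hlint])
  have hr1 : ∫ x, r x ∂P = 1 := by
    rw [integral_eq_lintegral_of_nonneg_ae (ae_of_all _ hr0) hrm.aestronglyMeasurable, hlint]
    simp
  have hplus := integrable_log_max_one hac hllr hrm hrint
  -- Since `L = log r - A`, the positive part of `L` is at most `(log r)⁺ + |A|`. It depends on `π`
  -- only, so its integrability passes to `ν₀`.
  have hLp : Integrable (fun x => max (L (π x)) 0) ν := by
    refine (hplus.add hA.abs).mono'
      ((hL.comp hπ).max measurable_const).aestronglyMeasurable ?_
    filter_upwards [hpos] with x hx
    have h1 := hlog x hx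
    have h2 : Real.log (r x) ≤ Real.log (max (r x) 1) := Real.log_le_log hx (le_max_left _ _)
    have h3 : 0 ≤ Real.log (max (r x) 1) := Real.log_nonneg (le_max_right _ _)
    rw [Real.norm_of_nonneg (le_max_right _ _)]
    exact max_le (by simp; linarith [neg_abs_le (A x)]) (by simp; positivity)
  have hLp₀ := (transfer (f := fun b => max (L b) 0) (by fun_prop)).1 hLp
  -- The negative part is always integrable under `ν₀`: multiplying `1 - 1/r ≤ log r` by `r` gives
  -- `-r log r ≤ 1 - r ≤ 1`.
  have hneg₀ : Integrable (fun x => max (-Real.log (r x)) 0) ν₀ := by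
    rw [hν₀, integrable_withDensity_iff_integrable_smul' hrm' (by simp)]
    refine (integrable_const (1 : ℝ)).mono' (by fun_prop) (ae_of_all _ fun x => ?_)
    rw [ENNReal.toReal_ofReal (hr0 x), smul_eq_mul,
      Real.norm_of_nonneg (mul_nonneg (hr0 x) (le_max_right _ _)), mul_max_of_nonneg _ _ (hr0 x)]
    refine max_le ?_ (by simp)
    rcases (hr0 x).eq_or_lt with h | h
    · simp [← h]
    · have h1 := Real.one_sub_inv_le_log_of_pos h
      have h2 := mul_le_mul_of_nonneg_left h1 h.le
      rw [mul_sub, mul_inv_cancel₀ h.ne'] at h2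
      linarith
  have hlog₀ : Integrable (fun x => Real.log (r x)) ν₀ := by
    refine ((hLp₀.add hA₀.abs).add hneg₀).mono' hrm.log.aestronglyMeasurable ?_
    filter_upwards [hpos₀] with x hx
    have h1 := hlog x hx
    simp only [Pi.add_apply, Real.norm_eq_abs]
    have := le_abs_self (A x)
    have := le_max_left (L (π x)) 0
    have := le_max_right (L (π x)) 0
    have := le_max_left (-Real.log (r x)) 0
    have := le_max_right (-Real.log (r x)) 0
    exact abs_le.2 ⟨by linarith [abs_nonneg (A x)], by linarith⟩
  have hae₀ : (fun x => Real.log (r x)) =ᵐ[ν₀] fun x => L (π x) + A x := by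
    filter_upwards [hpos₀] with x hx using hlog x hx
  have hae : (fun x => Real.log (r x)) =ᵐ[ν] fun x => L (π x) + A x := by
    filter_upwards [hpos] with x hx using hlog x hx
  have hL₀ : Integrable (fun x => L (π x)) ν₀ := by
    have := ((integrable_congr hae₀).1 hlog₀).sub hA₀
    exact this.congr (ae_of_all _ fun x => by simp)
  have hLν := (transfer hL).2 hL₀
  have hlogν : Integrable (fun x => Real.log (r x)) ν := (integrable_congr hae).2 (hLν.add hA)
  have heq : ∫ x, Real.log (r x) ∂ν₀ = ∫ x, Real.log (r x) ∂ν := by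
    rw [integral_congr_ae hae₀, integral_congr_ae hae, integral_add hL₀ hA₀, integral_add hLν hA,
      hAeq, ← integral_map hπ.aemeasurable hL.aestronglyMeasurable,
      ← integral_map hπ.aemeasurable hL.aestronglyMeasurable, hmap]
  have hac₀ : ν₀ ≪ P := hν₀ ▸ withDensity_absolutelyContinuous _ _
  have hllr₀ : llr ν₀ P =ᵐ[ν₀] fun x => Real.log (r x) := by
    have h := Measure.rnDeriv_withDensity P hrm'
    rw [← hν₀] at h
    filter_upwards [hac₀.ae_eq h] with x hx
    rw [llr, hx, ENNReal.toReal_ofReal (hr0 x)]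
  rw [InformationTheory.klDiv_of_ac_of_integrable hac₀ ((integrable_congr hllr₀).2 hlog₀),
    InformationTheory.klDiv_of_ac_of_integrable hac hllr, integral_congr_ae hllr₀, heq]
  simp only [probReal_univ, add_sub_cancel_right]
  exact ENNReal.ofReal_le_ofReal (integral_log_le_integral_llr hac hllr hr0 hrint hr1 hpos hlogν)

end Entropy

/-! ### Regular variation and Gaussian mixtures of a fat-tailed density. -/

section RegularVariation

lemma intervalIntegrable_min_one_abs {k : ℝ → ℝ} (hk : Measurable k) (x a b : ℝ) :
    IntervalIntegrable (fun u => min 1 |k (x + u) - k x|) volume a b := by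
  refine (intervalIntegrable_const (c := (1 : ℝ))).mono_fun'
    (Measurable.aestronglyMeasurable (by fun_prop)) (ae_of_all _ fun u => ?_)
  change ‖min 1 |k (x + u) - k x|‖ ≤ 1
  rw [Real.norm_of_nonneg (le_min zero_le_one (abs_nonneg _))]
  exact min_le_left _ _

/-- Local uniformity of slow variation, in additive form. -/
theorem tendsto_add_sub_of_measurable {k : ℝ → ℝ} (hk : Measurable k)
    (h : ∀ u, Tendsto (fun x => k (x + u) - k x) atTop (𝓝 0)) {w : ℝ → ℝ}
    (hw : Tendsto w atTop (𝓝 0)) : Tendsto (fun x => k (x + w x) - k x) atTop (𝓝 0) := by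
  -- Averaging replaces uniformity in `u`. Truncation at 1 permits dominated convergence with no
  -- bound on `k`, and the window `[-2, 2]` contains every translate of `[-1, 1]` by `|w x| ≤ 1`.
  set R : ℝ → ℝ := fun x => ∫ u in (-2 : ℝ)..2, min 1 |k (x + u) - k x| with hRdef
  have hR : Tendsto R atTop (𝓝 0) := by
    have key := intervalIntegral.tendsto_integral_filter_of_dominated_convergence
      (μ := volume) (a := (-2 : ℝ)) (b := 2) (l := atTop) (fun _ => (1 : ℝ))
      (F := fun x u => min 1 |k (x + u) - k x|) (f := fun _ => (0 : ℝ))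
      (Eventually.of_forall fun x => Measurable.aestronglyMeasurable (by fun_prop))
      (Eventually.of_forall fun x => ae_of_all _ fun u _ => by
        rw [Real.norm_of_nonneg (le_min zero_le_one (abs_nonneg _))]
        exact min_le_left _ _)
      intervalIntegrable_const
      (ae_of_all _ fun u _ => by
        simpa using (tendsto_const_nhds (x := (1 : ℝ))).min ((h u).abs))
    simpa using key
  have hR' : Tendsto (fun x => R (x + w x)) atTop (𝓝 0) :=
    hR.comp (tendsto_atTop_add_right_of_le' _ (-1) tendsto_id
      ((hw.eventually (lt_mem_nhds (by norm_num : (-1 : ℝ) < 0))).mono fun _ hx => hx.le))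
  have hbound : ∀ᶠ x in atTop, 2 * min 1 |k (x + w x) - k x| ≤ R x + R (x + w x) := by
    filter_upwards [hw.eventually (Icc_mem_nhds (by norm_num : (-1 : ℝ) < 0) zero_lt_one)]
      with x ⟨hx1, hx2⟩
    have mono : ∀ y a b : ℝ, -2 ≤ a → a ≤ b → b ≤ 2 →
        ∫ u in a..b, min 1 |k (y + u) - k y| ≤ R y := fun y a b h1 h2 h3 =>
      intervalIntegral.integral_mono_interval h1 h2 h3
        (ae_of_all _ fun u => le_min zero_le_one (abs_nonneg _))
        (intervalIntegrable_min_one_abs hk y _ _)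
    have e1 := mono x (-1) 1 (by norm_num) (by norm_num) (by norm_num)
    have e2 := mono (x + w x) (-1 - w x) (1 - w x) (by linarith) (by linarith) (by linarith)
    have e3 := intervalIntegral.integral_comp_sub_right (a := -1) (b := 1)
      (fun u => min 1 |k (x + w x + u) - k (x + w x)|) (w x)
    rw [← e3] at e2
    have i1 := intervalIntegrable_min_one_abs hk x (-1) 1
    have i2 : IntervalIntegrable (fun u => min 1 |k (x + w x + (u - w x)) - k (x + w x)|)
        volume (-1) 1 := by
      simpa using (intervalIntegrable_min_one_abs hk (x + w x) (-1 - w x) (1 - w x)).comp_sub_right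
        (w x)
    -- The increment from `x` to `x + w x` is compared through every intermediate point `x + u`, and
    -- the truncated triangle inequality is integrated over `u ∈ [-1, 1]`; the length of this
    -- interval is the factor 2.
    have e4 := intervalIntegral.integral_mono_on (a := (-1 : ℝ)) (b := 1) (by norm_num)
      (intervalIntegrable_const (c := min 1 |k (x + w x) - k x|)) (i1.add i2) fun u _ => by
        have hu : x + w x + (u - w x) = x + u := by ring
        simp only [hu]
        have htri : |k (x + w x) - k x| ≤ |k (x + u) - k x| + |k (x + u) - k (x + w x)| := by
          rw [abs_sub_comm (k (x + u)) (k (x + w x))]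
          linarith [abs_sub_le (k (x + w x)) (k (x + u)) (k x)]
        rcases le_total 1 |k (x + u) - k x| with h1 | h1
        · rw [min_eq_left h1]
          exact (min_le_left _ _).trans
            (le_add_of_nonneg_right (le_min zero_le_one (abs_nonneg _)))
        rcases le_total 1 |k (x + u) - k (x + w x)| with h2 | h2
        · rw [min_eq_left h2]
          exact (min_le_left _ _).trans
            (le_add_of_nonneg_left (le_min zero_le_one (abs_nonneg _)))
        rw [min_eq_right h1, min_eq_right h2]
        exact (min_le_right _ _).trans htri
    rw [intervalIntegral.integral_const, intervalIntegral.integral_add i1 i2, smul_eq_mul] at e4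
    linarith
  have hmin : Tendsto (fun x => 2 * min 1 |k (x + w x) - k x|) atTop (𝓝 0) :=
    tendsto_of_tendsto_of_tendsto_of_le_of_le' tendsto_const_nhds (by simpa using hR.add hR')
      (Eventually.of_forall fun x => by positivity) hbound
  rw [Metric.tendsto_nhds]
  intro ε hε
  filter_upwards [hmin.eventually (gt_mem_nhds (show (0 : ℝ) < 2 * min 1 ε by positivity))]
    with x hx
  rw [Real.dist_eq, sub_zero]
  have h1 : min 1 |k (x + w x) - k x| < min 1 ε := by linarith
  rcases min_lt_iff.1 (h1.trans_le (min_le_left _ _)) with h2 | h2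
  · exact absurd h2 (lt_irrefl _)
  · rw [min_eq_right h2.le] at h1
    exact h1.trans_le (min_le_right _ _)

variable {g : ℝ → ℝ} {α : ℝ}

lemma IsProbDensity.eventually_pos (hg : IsProbDensity g) (hα : FatTailed g α) :
    ∀ᶠ t in atTop, 0 < g t := by
  -- With `η = 1` the ratio is `g t / g t`, which is 0 when `g t = 0`; a limit of 1 excludes this
  -- for large `t`.
  have h := hα.regularlyVarying 1 one_pos
  simp only [one_mul, Real.one_rpow, div_one] at h
  filter_upwards [h.eventually (lt_mem_nhds (zero_lt_one' ℝ))] with t ht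
  refine (hg.nonneg t).lt_of_ne fun h0 => ?_
  simp [← h0] at ht

/-- In the variable `y = log t` the slowly varying factor `t ^ α g t` has logarithm `log (g (exp y))
+ α y`, so regular variation becomes vanishing of increments. -/
lemma FatTailed.tendsto_log_add_sub (hα : FatTailed g α) (hg : IsProbDensity g) (u : ℝ) :
    Tendsto (fun y => (Real.log (g (Real.exp (y + u))) + α * (y + u)) -
      (Real.log (g (Real.exp y)) + α * y)) atTop (𝓝 0) := by
  have hpos := Real.tendsto_exp_atTop.eventually (hg.eventually_pos hα)
  have hpos' : ∀ᶠ y in atTop, 0 < g (Real.exp (y + u)) :=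
    (Real.tendsto_exp_atTop.comp (tendsto_atTop_add_const_right _ u tendsto_id)).eventually
      (hg.eventually_pos hα)
  have h1 := ((hα.regularlyVarying (Real.exp u) (Real.exp_pos u)).comp
    Real.tendsto_exp_atTop).log (by positivity)
  rw [one_div, Real.log_inv, Real.log_rpow (Real.exp_pos u), Real.log_exp] at h1
  have h2 := h1.add_const (α * u)
  rw [neg_add_cancel] at h2
  refine h2.congr' ?_
  filter_upwards [hpos, hpos'] with y hy hy'
  have he : Real.exp u * Real.exp y = Real.exp (y + u) := by rw [← Real.exp_add, add_comm]
  simp only [Function.comp_apply, he, Real.log_div hy'.ne' hy.ne']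
  ring

/-- Moving `t` by `-d` moves `log t` by `log (1 - d / t)`, which tends to 0 but varies with `t`:
hence the need for local uniformity. -/
lemma FatTailed.tendsto_sub_div (hα : FatTailed g α) (hg : IsProbDensity g) (d : ℝ) :
    Tendsto (fun t => g (t - d) / g t) atTop (𝓝 1) := by
  have hgm := hg.measurable
  have hinner : Tendsto (fun y => 1 - d * Real.exp (-y)) atTop (𝓝 1) := by
    simpa using ((Real.tendsto_exp_neg_atTop_nhds_zero).const_mul d).const_sub 1
  have hw : Tendsto (fun y => Real.log (1 - d * Real.exp (-y))) atTop (𝓝 0) := by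
    simpa using hinner.log one_ne_zero
  have h1 := tendsto_add_sub_of_measurable
    (k := fun y => Real.log (g (Real.exp y)) + α * y) (by fun_prop)
    (hα.tendsto_log_add_sub hg) hw
  have h2 : Tendsto (fun y => Real.log (g (Real.exp y - d) / g (Real.exp y))) atTop (𝓝 0) := by
    have h3 := h1.sub (hw.const_mul α)
    rw [mul_zero, sub_zero] at h3
    refine h3.congr' ?_
    have hpos := Real.tendsto_exp_atTop.eventually (hg.eventually_pos hα)
    have hpos' : ∀ᶠ y in atTop, 0 < g (Real.exp y - d) :=
      (tendsto_atTop_add_const_right _ (-d) Real.tendsto_exp_atTop).eventually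
        (hg.eventually_pos hα)
    filter_upwards [hpos, hpos', hinner.eventually (lt_mem_nhds (zero_lt_one' ℝ))]
      with y hy hy' hi
    have he : Real.exp (y + Real.log (1 - d * Real.exp (-y))) = Real.exp y - d := by
      rw [Real.exp_add, Real.exp_log hi, mul_sub, Real.exp_neg]
      field_simp
    rw [he, Real.log_div hy'.ne' hy.ne']
    ring
  have h4 := (Real.continuous_exp.tendsto 0).comp (h2.comp Real.tendsto_log_atTop)
  rw [Real.exp_zero] at h4
  refine h4.congr' ?_
  have hpos' : ∀ᶠ t in atTop, 0 < g (t - d) :=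
    (tendsto_atTop_add_const_right _ (-d) tendsto_id).eventually (hg.eventually_pos hα)
  filter_upwards [hg.eventually_pos hα, hpos', eventually_gt_atTop 0] with t ht ht' h0
  simp only [Function.comp_apply, Real.exp_log h0]
  exact Real.exp_log (div_pos ht' ht)

/-- Factor the ratio through `g (t - d)`: scaling contributes `b ^ (-α)`, the shift contributes 1.
-/
lemma FatTailed.tendsto_mul_sub_div (hα : FatTailed g α) (hg : IsProbDensity g) {b : ℝ}
    (hb : 0 < b) (d : ℝ) : Tendsto (fun t => g (b * (t - d)) / g t) atTop (𝓝 (1 / b ^ α)) := by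
  have h1 := ((hα.regularlyVarying b hb).comp
    (tendsto_atTop_add_const_right _ (-d) tendsto_id)).mul (hα.tendsto_sub_div hg d)
  rw [mul_one] at h1
  refine h1.congr' ?_
  have hpos' : ∀ᶠ t in atTop, 0 < g (t - d) :=
    (tendsto_atTop_add_const_right _ (-d) tendsto_id).eventually (hg.eventually_pos hα)
  filter_upwards [hpos'] with t ht
  simp only [Function.comp_apply, id_eq, ← sub_eq_add_neg]
  field_simp

/-- Substitute `u = t - c - ρ x`; the factor `ρ⁻¹` is the Jacobian. -/
lemma integral_mul_gaussianPDFReal_affine (g : ℝ → ℝ) {v : NNReal} (hv : v ≠ 0) {ρ : ℝ}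
    (hρ : 0 < ρ) (c t : ℝ) :
    ∫ x, g x * gaussianPDFReal (c + x * ρ) v t =
      ρ⁻¹ * ∫ u, g (ρ⁻¹ * (t - u - c)) ∂gaussianReal 0 v := by
  rw [integral_gaussianReal_eq_integral_smul hv]
  have h1 := integral_sub_left_eq_self
    (fun u => gaussianPDFReal 0 v u • g (ρ⁻¹ * (t - u - c))) volume (t - c)
  have h2 := Measure.integral_comp_mul_left
    (fun x => g x * gaussianPDFReal (c + x * ρ) v t) ρ⁻¹
  rw [inv_inv, abs_of_pos hρ, smul_eq_mul] at h2
  rw [← h1, eq_inv_mul_iff_mul_eq₀ hρ.ne', ← h2]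
  refine integral_congr_ae (ae_of_all _ fun u => ?_)
  have e1 : ρ⁻¹ * u * ρ = u := by field_simp
  have e2 : t - (t - c - u) - c = u := by ring
  simp only [gaussianPDFReal, smul_eq_mul, e1, e2]
  rw [mul_comm, show t - c - u - 0 = t - (c + u) by ring]

/-- A regularly varying density is reproduced in the tail of its affine Gaussian mixture. -/
theorem FatTailed.tendsto_gaussian_mixture_div (hα : FatTailed g α) (hg : IsProbDensity g)
    {v : NNReal} (hv : v ≠ 0) {ρ : ℝ} (hρ : 0 < ρ) (c : ℝ) :
    Tendsto (fun t => (∫ x, g x * gaussianPDFReal (c + x * ρ) v t) / g t) atTop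
      (𝓝 (ρ ^ (α - 1))) := by
  have hgm := hg.measurable
  obtain ⟨h, -, hint, hdom⟩ := hα.dominated c ρ⁻¹ (inv_pos.2 hρ)
  have key := tendsto_integral_filter_of_dominated_convergence
    (μ := gaussianReal 0 v) (l := atTop) h
    (F := fun t u => g (ρ⁻¹ * (t - u - c)) / g t) (f := fun _ => 1 / ρ⁻¹ ^ α)
    (Eventually.of_forall fun t => Measurable.aestronglyMeasurable (by fun_prop))
    (hdom.mono fun t ht => ae_of_all _ fun u => by
      rw [Real.norm_of_nonneg (div_nonneg (hg.nonneg _) (hg.nonneg _))]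
      exact ht u)
    (hint 0 v)
    (ae_of_all _ fun u => by
      simpa only [sub_sub] using hα.tendsto_mul_sub_div hg (inv_pos.2 hρ) (u + c))
  rw [integral_const, probReal_univ, one_smul] at key
  have hlim : ρ⁻¹ * (1 / ρ⁻¹ ^ α) = ρ ^ (α - 1) := by
    rw [Real.inv_rpow hρ.le, one_div, inv_inv, Real.rpow_sub_one hρ.ne']
    ring
  have h2 := key.const_mul ρ⁻¹
  rw [hlim] at h2
  refine h2.congr fun t => ?_
  rw [integral_mul_gaussianPDFReal_affine g hv hρ, integral_div, mul_div_assoc]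

end RegularVariation

/-! ### Gaussian densities: Schur complements, conditioning and marginals. -/

noncomputable section

section GaussianDensity

variable {ι : Type}

/-- The covariance matrix with scalar upper left block `A`, off-diagonal blocks `σ`, `σᵀ` and lower
right block `D`. -/
abbrev scalarBlocks {ι : Type} (A : ℝ) (σ : ι → ℝ) (D : Matrix ι ι ℝ) :
    Matrix (Unit ⊕ ι) (Unit ⊕ ι) ℝ :=
  Matrix.fromBlocks (Matrix.of fun _ _ => A) (Matrix.of fun _ j => σ j)
    (Matrix.of fun j _ => σ j) D

/-- The Schur complement of the scalar block, that is, the conditional covariance matrix. -/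
abbrev condCov {ι : Type} (A : ℝ) (σ : ι → ℝ) (D : Matrix ι ι ℝ) : Matrix ι ι ℝ :=
  D - (1 / A) • Matrix.vecMulVec σ σ

variable {A : ℝ} {σ : ι → ℝ} {D : Matrix ι ι ℝ}

lemma Matrix.PosDef.scalarBlocks_pos (h : (scalarBlocks A σ D).PosDef) : 0 < A := by
  simpa using h.diag_pos (i := Sum.inl ())

lemma Matrix.PosDef.toNNReal_diag_ne_zero {S : Matrix ι ι ℝ} (hS : S.PosDef) (i : ι) :
    (S i i).toNNReal ≠ 0 := by
  simpa using hS.diag_pos (i := i)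

/-- Separating the coordinate `i` from the others. -/
def splitCoord [DecidableEq ι] (i : ι) : Unit ⊕ {j : ι // j ≠ i} ≃ ι :=
  (Equiv.sumCongr (Equiv.ofUnique Unit {j : ι // j = i}) (Equiv.refl _)).trans
    (Equiv.sumCompl (· = i))

@[simp] lemma splitCoord_inl [DecidableEq ι] (i : ι) (u : Unit) : splitCoord i (Sum.inl u) = i := by
  exact (default : {j : ι // j = i}).2

@[simp] lemma splitCoord_inr [DecidableEq ι] (i : ι) (j : {j : ι // j ≠ i}) :
    splitCoord i (Sum.inr j) = j := by
  simp [splitCoord]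

/-- The covariances of the coordinate `i` with the others. -/
abbrev restCov (S : Matrix ι ι ℝ) (i : ι) (j : {j : ι // j ≠ i}) : ℝ := S i j

/-- The conditional covariance matrix of the other coordinates given the coordinate `i`. -/
abbrev condCovAt (S : Matrix ι ι ℝ) (i : ι) : Matrix {j : ι // j ≠ i} {j : ι // j ≠ i} ℝ :=
  condCov (S i i) (restCov S i) (S.submatrix Subtype.val Subtype.val)

lemma submatrix_splitCoord [DecidableEq ι] {S : Matrix ι ι ℝ} (hS : S.PosDef) (i : ι) :
    S.submatrix (splitCoord i) (splitCoord i) =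
      scalarBlocks (S i i) (restCov S i) (S.submatrix Subtype.val Subtype.val) := by
  ext (a | a) (b | b)
  · simp
  · simp
  · simpa using hS.1.apply i a
  · simp

lemma posDef_scalarBlocks_splitCoord [DecidableEq ι] {S : Matrix ι ι ℝ} (hS : S.PosDef) (i : ι) :
    (scalarBlocks (S i i) (restCov S i) (S.submatrix Subtype.val Subtype.val)).PosDef := by
  rw [← submatrix_splitCoord hS]
  exact hS.submatrix (splitCoord i).injective

variable [Fintype ι]

lemma scalarBlocks_mulVec (p : ℝ) (q : ι → ℝ) :
    (scalarBlocks A σ D).mulVec (Sum.elim (fun _ => p) q) =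
      Sum.elim (fun _ => A * p + σ ⬝ᵥ q) (p • σ + D.mulVec q) := by
  ext (j | j)
  · simp [Matrix.mulVec, dotProduct]
  · simp [Matrix.mulVec, dotProduct, mul_comm]

lemma condCov_mulVec (q : ι → ℝ) :
    (condCov A σ D).mulVec q = D.mulVec q - ((σ ⬝ᵥ q) / A) • σ := by
  rw [Matrix.sub_mulVec, Matrix.smul_mulVec, Matrix.vecMulVec_mulVec]
  ext j
  simp
  ring

lemma Matrix.PosDef.condCov (h : (scalarBlocks A σ D).PosDef) : (condCov A σ D).PosDef := by
  have hA := h.scalarBlocks_pos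
  have hD : D.IsHermitian := (Matrix.isHermitian_fromBlocks_iff.1 h.1).2.2.2
  refine .of_dotProduct_mulVec_pos (hD.sub ?_) fun x hx => ?_
  · ext i j
    simp [Matrix.vecMulVec_apply, mul_comm]
  -- The scalar coordinate `-(σ ⬝ᵥ x) / A` minimizes the block quadratic form for fixed `x`, and the
  -- minimum is the form of the Schur complement.
  · have hne : Sum.elim (fun _ : Unit => -(σ ⬝ᵥ x) / A) x ≠ 0 := fun h0 => hx <| by
      ext j
      simpa using congrFun h0 (Sum.inr j)
    have h1 := h.dotProduct_mulVec_pos hne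
    rw [scalarBlocks_mulVec] at h1
    rw [condCov_mulVec]
    simp only [star_trivial, sumElim_dotProduct_sumElim,
      dotProduct_add, dotProduct_sub, dotProduct_smul, smul_eq_mul] at h1 ⊢
    have e : A * (-(σ ⬝ᵥ x) / A) + σ ⬝ᵥ x = 0 := by field_simp; ring
    rw [e] at h1
    simp only [dotProduct, Finset.univ_unique, Finset.sum_singleton, mul_zero, zero_add] at h1 ⊢
    convert h1 using 1
    ring

variable [DecidableEq ι]

lemma det_scalarBlocks (hA : A ≠ 0) :
    (scalarBlocks A σ D).det = A * (condCov A σ D).det := by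
  let B : Matrix Unit Unit ℝ := Matrix.of fun _ _ => A
  have hB : B.det = A := by simp [B]
  have : Invertible B := Matrix.invertibleOfIsUnitDet B (by rw [hB]; exact hA.isUnit)
  have hinv : ⅟B = Matrix.of fun _ _ => A⁻¹ := by
    rw [invOf_eq_right_inv]
    ext
    simp [B, Matrix.mul_apply, hA]
  have h := Matrix.det_fromBlocks₁₁ B (Matrix.of fun _ j => σ j) (Matrix.of fun j _ => σ j) D
  rw [hB, hinv] at h
  rw [scalarBlocks, h]
  congr 2
  ext i j
  simp [Matrix.mul_apply, Matrix.vecMulVec_apply]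
  ring

lemma Matrix.PosDef.mulVec_inv_mulVec {M : Matrix ι ι ℝ} (h : M.PosDef) (x : ι → ℝ) :
    M.mulVec (M⁻¹.mulVec x) = x := by
  rw [Matrix.mulVec_mulVec, Matrix.mul_nonsing_inv _ ((Matrix.isUnit_iff_isUnit_det _).1 h.isUnit),
    Matrix.one_mulVec]

lemma scalarBlocks_inv_quadratic (h : (scalarBlocks A σ D).PosDef) (p : ℝ) (q : ι → ℝ) :
    Sum.elim (fun _ => p) q ⬝ᵥ (scalarBlocks A σ D)⁻¹.mulVec (Sum.elim (fun _ => p) q) =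
      p ^ 2 / A + (q - (p / A) • σ) ⬝ᵥ (condCov A σ D)⁻¹.mulVec (q - (p / A) • σ) := by
  have hA := h.scalarBlocks_pos
  set z := (condCov A σ D)⁻¹.mulVec (q - (p / A) • σ) with hz
  have hTz : (condCov A σ D).mulVec z = q - (p / A) • σ := h.condCov.mulVec_inv_mulVec _
  rw [condCov_mulVec] at hTz
  -- Block elimination: this vector solves the linear system with right side `(p, q)`, so the
  -- inverse matrix need not be computed.
  have hM : (scalarBlocks A σ D).mulVec (Sum.elim (fun _ => (p - σ ⬝ᵥ z) / A) z) =
      Sum.elim (fun _ => p) q := by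
    rw [scalarBlocks_mulVec]
    congr 1
    · ext
      field_simp
      ring
    · rw [sub_eq_iff_eq_add] at hTz
      rw [hTz, sub_div, sub_smul]
      abel
  have hinv : (scalarBlocks A σ D)⁻¹.mulVec (Sum.elim (fun _ => p) q) =
      Sum.elim (fun _ => (p - σ ⬝ᵥ z) / A) z := by
    rw [← hM, Matrix.mulVec_mulVec,
      Matrix.nonsing_inv_mul _ ((Matrix.isUnit_iff_isUnit_det _).1 h.isUnit), Matrix.one_mulVec]
  rw [hinv, sumElim_dotProduct_sumElim, sub_dotProduct, smul_dotProduct]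
  simp only [dotProduct, Finset.univ_unique, Finset.sum_singleton, smul_eq_mul]
  ring

/-- The joint Gaussian density is the density of the scalar coordinate times the conditional density
of the other coordinates. -/
lemma gaussianDensity_scalarBlocks (h : (scalarBlocks A σ D).PosDef) (m₁ : ℝ) (m₂ : ι → ℝ) (s : ℝ)
    (q : ι → ℝ) :
    gaussianDensity (Sum.elim (fun _ => m₁) m₂) (scalarBlocks A σ D) (Sum.elim (fun _ => s) q) =
      gaussianPDFReal m₁ A.toNNReal s *
        gaussianDensity (m₂ + ((s - m₁) / A) • σ) (condCov A σ D) q := by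
  have hA := h.scalarBlocks_pos
  have hsub : (Sum.elim (fun _ => s) q - Sum.elim (fun _ => m₁) m₂ : Unit ⊕ ι → ℝ) =
      Sum.elim (fun _ => s - m₁) (q - m₂) := by
    ext (j | j) <;> simp
  have hq : q - (m₂ + ((s - m₁) / A) • σ) = q - m₂ - ((s - m₁) / A) • σ := by abel
  rw [gaussianDensity, gaussianDensity, gaussianPDFReal, hsub, hq,
    scalarBlocks_inv_quadratic h, det_scalarBlocks hA.ne', Real.coe_toNNReal _ hA.le,
    Fintype.card_sum, Fintype.card_unit, pow_add, pow_one]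
  have e1 : 2 * Real.pi * (2 * Real.pi) ^ Fintype.card ι * (A * (condCov A σ D).det) =
      (2 * Real.pi * A) * ((2 * Real.pi) ^ Fintype.card ι * (condCov A σ D).det) := by ring
  rw [e1, Real.sqrt_mul (by positivity), mul_inv, mul_add, Real.exp_add]
  have e2 : -(1 / 2) * ((s - m₁) ^ 2 / A) = -(s - m₁) ^ 2 / (2 * A) := by
    field_simp
  rw [e2]
  ring

lemma gaussianDensity_reindex {κ : Type} [Fintype κ] [DecidableEq κ] (e : κ ≃ ι) (m : ι → ℝ)
    (S : Matrix ι ι ℝ) (y : ι → ℝ) :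
    gaussianDensity (m ∘ e) (S.submatrix e e) (y ∘ e) = gaussianDensity m S y := by
  have h : y ∘ e - m ∘ e = (y - m) ∘ e := rfl
  rw [gaussianDensity, gaussianDensity, Fintype.card_congr e, Matrix.det_submatrix_equiv_self,
    Matrix.inv_submatrix_equiv, h, Matrix.submatrix_mulVec_equiv]
  have h2 : ((y - m) ∘ e) ∘ e.symm = y - m := by ext; simp
  rw [h2, comp_equiv_dotProduct_comp_equiv]

lemma gaussianDensity_pos {S : Matrix ι ι ℝ} (hS : S.PosDef) (m y : ι → ℝ) :
    0 < gaussianDensity m S y := by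
  have := hS.det_pos
  have := Real.pi_pos
  unfold gaussianDensity
  positivity

lemma continuous_gaussianDensity {X : Type*} [TopologicalSpace X] {m y : X → ι → ℝ}
    (hm : Continuous m) (hy : Continuous y) (S : Matrix ι ι ℝ) :
    Continuous fun x => gaussianDensity (m x) S (y x) := by
  unfold gaussianDensity
  have h := hy.sub hm
  exact continuous_const.mul (Real.continuous_exp.comp (continuous_const.mul
    (h.dotProduct (continuous_const.matrix_mulVec h))))

/-- The vector with coordinate `p.1` at `i` and the coordinates `p.2` elsewhere. -/
def glueCoord {ι : Type} [DecidableEq ι] (i : ι) (p : ℝ × ({j : ι // j ≠ i} → ℝ)) : ι → ℝ :=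
  fun j => if h : j = i then p.1 else p.2 ⟨j, h⟩

lemma gaussianDensity_split {S : Matrix ι ι ℝ} (hS : S.PosDef) (i : ι) (m : ι → ℝ) (s : ℝ)
    (q : {j : ι // j ≠ i} → ℝ) :
    gaussianDensity m S (glueCoord i (s, q)) =
      gaussianPDFReal (m i) (S i i).toNNReal s *
        gaussianDensity ((fun j : {j : ι // j ≠ i} => m j) + ((s - m i) / S i i) • restCov S i) (condCovAt S i) q := by
  rw [← gaussianDensity_scalarBlocks (posDef_scalarBlocks_splitCoord hS i),
    ← submatrix_splitCoord hS, ← gaussianDensity_reindex (splitCoord i)]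
  congr 1
  · ext (j | j) <;> simp
  · ext (j | j)
    · simp [glueCoord]
    · simp [glueCoord, j.2]

lemma measurePreserving_glue (i : ι) :
    MeasurePreserving (glueCoord i) volume volume := by
  have h1 := (volume_preserving_piEquivPiSubtypeProd (fun _ : ι => ℝ) (· = i)).symm
  have h2 : MeasurePreserving
      (Prod.map (MeasurableEquiv.funUnique {j : ι // j = i} ℝ).symm id)
      (volume : Measure (ℝ × ({j : ι // ¬ j = i} → ℝ))) volume := ((volume_preserving_funUnique {j : ι // j = i} ℝ).symm).prod
    (MeasurePreserving.id (volume : Measure ({j : ι // ¬ j = i} → ℝ)))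
  -- The singleton subtype carries two different `Fintype` instances, which must be identified
  -- before the maps compose.
  rw [Subsingleton.elim (Subtype.fintype fun j => j = i) (Fintype.subtypeEq i)] at h1
  convert! h1.comp h2 using 1

/-- Normalization of the conditional density is the hypothesis `hone`, so that the lemma can serve
first in the induction on dimension that proves normalization, and then for the marginals. -/
lemma lintegral_gaussianDensity_eq_lintegral_split {S : Matrix ι ι ℝ} (hS : S.PosDef) (i : ι)
    (m : ι → ℝ) {F : ℝ → ENNReal} (hF : Measurable F)
    (hone : ∀ m', ∫⁻ q, ENNReal.ofReal (gaussianDensity m' (condCovAt S i) q) = 1) :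
    ∫⁻ y, F (y i) * ENNReal.ofReal (gaussianDensity m S y) =
      ∫⁻ s, F s * gaussianPDF (m i) (S i i).toNNReal s := by
  have hm : Measurable fun y => ENNReal.ofReal (gaussianDensity m S y) :=
    (continuous_gaussianDensity continuous_const continuous_id S).measurable.ennreal_ofReal
  have hglue := measurePreserving_glue i
  have hFm : Measurable fun y : ι → ℝ => F (y i) * ENNReal.ofReal (gaussianDensity m S y) :=
    (hF.comp (measurable_pi_apply i)).mul hm
  rw [← hglue.lintegral_comp hFm]
  refine (lintegral_prod _ (hFm.comp hglue.measurable).aemeasurable).trans ?_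
  refine lintegral_congr fun s => ?_
  have hmq : ∀ m', Measurable fun q => ENNReal.ofReal (gaussianDensity m' (condCovAt S i) q) :=
    fun m' => (continuous_gaussianDensity continuous_const continuous_id _).measurable.ennreal_ofReal
  have hi : ∀ q, glueCoord i (s, q) i = s := fun q => by simp [glueCoord]
  simp only [Function.comp_apply, hi, gaussianDensity_split hS,
    ENNReal.ofReal_mul (gaussianPDFReal_nonneg _ _ _), ← mul_assoc]
  rw [lintegral_const_mul _ (hmq _), hone, mul_one]
  rfl

theorem lintegral_gaussianDensity {S : Matrix ι ι ℝ} (hS : S.PosDef) (m : ι → ℝ) :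
    ∫⁻ y, ENNReal.ofReal (gaussianDensity m S y) = 1 := by
  induction hn : Fintype.card ι generalizing ι with
  | zero =>
    have := Fintype.card_eq_zero_iff.1 hn
    rw [volume_pi, Measure.pi_of_empty _ (m - m), lintegral_dirac]
    simp [gaussianDensity]
  | succ n ih =>
    have : Nonempty ι := Fintype.card_pos_iff.1 (by omega)
    obtain ⟨i⟩ := ‹Nonempty ι›
    have hcard : Fintype.card {j : ι // j ≠ i} = n := by
      rw [Fintype.card_subtype_compl, Fintype.card_subtype_eq]
      omega
    have h := lintegral_gaussianDensity_eq_lintegral_split hS i m (measurable_const (a := 1))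
      fun m' => ih (posDef_scalarBlocks_splitCoord hS i).condCov m' hcard
    simp only [one_mul] at h
    rw [h, lintegral_gaussianPDF_eq_one _ (hS.toNNReal_diag_ne_zero i)]

/-- The coordinates of a Gaussian vector are Gaussian. -/
theorem lintegral_comp_eval_gaussianDensity {S : Matrix ι ι ℝ} (hS : S.PosDef) (i : ι)
    (m : ι → ℝ) {F : ℝ → ENNReal} (hF : Measurable F) :
    ∫⁻ y, F (y i) * ENNReal.ofReal (gaussianDensity m S y) =
      ∫⁻ s, F s ∂gaussianReal (m i) (S i i).toNNReal := by
  rw [lintegral_gaussianDensity_eq_lintegral_split hS i m hF fun m' =>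
    lintegral_gaussianDensity (posDef_scalarBlocks_splitCoord hS i).condCov m',
    gaussianReal_of_var_ne_zero _ (hS.toNNReal_diag_ne_zero i),
    lintegral_withDensity_eq_lintegral_mul _ (measurable_gaussianPDF _ _) hF]
  simp only [Pi.mul_apply, mul_comm]

end GaussianDensity
end

/-! ### Joint laws `g(x)` times a Gaussian density in `y` with mean depending on `x`; prior and
posterior are both of this form. -/

section GaussianMixture

variable {k : ℕ} {T : Matrix (Fin k) (Fin k) ℝ} {g : ℝ → ℝ} {m : ℝ → Fin k → ℝ}
  {f : ℝ × (Fin k → ℝ) → ℝ}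

lemma map_eval_gaussianDensity (hT : T.PosDef) (c : Fin k → ℝ) (j : Fin k) :
    (volume.withDensity fun y => ENNReal.ofReal (gaussianDensity c T y)).map (fun y => y j) =
      gaussianReal (c j) (T j j).toNNReal := by
  have hm : Measurable fun y => ENNReal.ofReal (gaussianDensity c T y) :=
    (continuous_gaussianDensity continuous_const continuous_id T).measurable.ennreal_ofReal
  refine Measure.ext_of_lintegral _ fun F hF => ?_
  rw [lintegral_map hF (measurable_pi_apply j), lintegral_withDensity_eq_lintegral_mul _ hm
    (g := fun y => F (y j)) (hF.comp (measurable_pi_apply j)), ← lintegral_comp_eval_gaussianDensity hT j c hF]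
  simp only [Pi.mul_apply, mul_comm]

lemma integral_gaussianDensity_mul_eval (hT : T.PosDef) (c : Fin k → ℝ) (j : Fin k) :
    ∫ y, gaussianDensity c T y * y j = c j := by
  have hm : Measurable fun y => ENNReal.ofReal (gaussianDensity c T y) :=
    (continuous_gaussianDensity continuous_const continuous_id T).measurable.ennreal_ofReal
  have h := integral_id_gaussianReal (μ := c j) (v := (T j j).toNNReal)
  rw [← map_eval_gaussianDensity hT, integral_map (φ := fun y : Fin k → ℝ => y j)
    (measurable_pi_apply j).aemeasurable (f := fun s => s) aestronglyMeasurable_id, integral_withDensity_eq_integral_toReal_smul hm (by simp)] at h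
  simpa only [ENNReal.toReal_ofReal (gaussianDensity_pos hT _ _).le, smul_eq_mul] using h

/-- The bound separates a constant from `|c|`, so the first moment of a mixture is finite once `g`
and `g * m j` are integrable. -/
lemma lintegral_enorm_gaussianReal_le (c : ℝ) (v : NNReal) :
    ∫⁻ s, ‖s‖ₑ ∂gaussianReal c v ≤ ∫⁻ s, ‖s‖ₑ ∂gaussianReal 0 v + ‖c‖ₑ := by
  have h := gaussianReal_map_add_const (μ := 0) (v := v) c
  rw [zero_add] at h
  rw [← h, lintegral_map measurable_enorm (measurable_add_const c)]
  calc ∫⁻ s, ‖s + c‖ₑ ∂gaussianReal 0 v ≤ ∫⁻ s, (‖s‖ₑ + ‖c‖ₑ) ∂gaussianReal 0 v :=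
        lintegral_mono fun s => enorm_add_le _ _
    _ = _ := by rw [lintegral_add_right _ measurable_const]; simp

lemma lintegral_enorm_gaussianReal_lt_top (v : NNReal) :
    ∫⁻ s, ‖s‖ₑ ∂gaussianReal 0 v < ⊤ :=
  ((memLp_id_gaussianReal (μ := 0) (v := v) 1).integrable (by simp)).2

lemma measurable_gaussianMixture (hg : Measurable g) (hm : Continuous m)
    (hf : ∀ p, f p = g p.1 * gaussianDensity (m p.1) T p.2) : Measurable f := by
  rw [funext hf]
  exact (hg.comp measurable_fst).mul
    (continuous_gaussianDensity (hm.comp continuous_fst) continuous_snd T).measurable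

lemma lintegral_jointLaw_gaussianMixture (hg : Measurable g) (hg0 : ∀ x, 0 ≤ g x)
    (hm : Continuous m) (hf : ∀ p, f p = g p.1 * gaussianDensity (m p.1) T p.2)
    {F : ℝ × (Fin k → ℝ) → ENNReal} (hF : Measurable F) :
    ∫⁻ p, F p ∂jointLaw f = ∫⁻ x, ENNReal.ofReal (g x) *
      ∫⁻ y, F (x, y) * ENNReal.ofReal (gaussianDensity (m x) T y) := by
  have hfm := (measurable_gaussianMixture hg hm hf).ennreal_ofReal
  rw [jointLaw, lintegral_withDensity_eq_lintegral_mul _ hfm hF]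
  refine (lintegral_prod _ (hfm.mul hF).aemeasurable).trans (lintegral_congr fun x => ?_)
  have hq : Measurable fun y => ENNReal.ofReal (gaussianDensity (m x) T y) :=
    (continuous_gaussianDensity continuous_const continuous_id T).measurable.ennreal_ofReal
  have hFx : Measurable fun y => F (x, y) := hF.comp measurable_prodMk_left
  have hFq : Measurable fun y => F (x, y) * ENNReal.ofReal (gaussianDensity (m x) T y) :=
    hFx.mul hq
  rw [← lintegral_const_mul _ hFq]
  refine lintegral_congr fun y => ?_
  rw [Pi.mul_apply, hf, ENNReal.ofReal_mul (hg0 x)]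
  ring

lemma map_fst_jointLaw_gaussianMixture (hT : T.PosDef) (hg : Measurable g) (hg0 : ∀ x, 0 ≤ g x)
    (hm : Continuous m) (hf : ∀ p, f p = g p.1 * gaussianDensity (m p.1) T p.2) :
    (jointLaw f).map Prod.fst = volume.withDensity fun x => ENNReal.ofReal (g x) := by
  refine Measure.ext_of_lintegral _ fun F hF => ?_
  rw [lintegral_map hF measurable_fst, lintegral_jointLaw_gaussianMixture hg hg0 hm hf
    (F := fun p => F p.1) (hF.comp measurable_fst), lintegral_withDensity_eq_lintegral_mul _ hg.ennreal_ofReal hF]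
  refine lintegral_congr fun x => ?_
  have hq : Measurable fun y => ENNReal.ofReal (gaussianDensity (m x) T y) :=
    (continuous_gaussianDensity continuous_const continuous_id T).measurable.ennreal_ofReal
  rw [Pi.mul_apply, lintegral_const_mul (F x) hq, lintegral_gaussianDensity hT, mul_one]

lemma integrable_eval_jointLaw_gaussianMixture (hT : T.PosDef) (hg : Measurable g)
    (hg0 : ∀ x, 0 ≤ g x) (hm : Continuous m)
    (hf : ∀ p, f p = g p.1 * gaussianDensity (m p.1) T p.2) (hgi : Integrable g) (j : Fin k)
    (hmi : Integrable fun x => g x * m x j) : Integrable (fun p => p.2 j) (jointLaw f) := by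
  have hmeas : Measurable fun p : ℝ × (Fin k → ℝ) => p.2 j :=
    (measurable_pi_apply j).comp measurable_snd
  refine ⟨hmeas.aestronglyMeasurable, ?_⟩
  set C := ∫⁻ s, ‖s‖ₑ ∂gaussianReal 0 (T j j).toNNReal
  calc ∫⁻ p, ‖p.2 j‖ₑ ∂jointLaw f
      ≤ ∫⁻ x, (ENNReal.ofReal (g x) * C + ‖g x * m x j‖ₑ) := by
        rw [lintegral_jointLaw_gaussianMixture hg hg0 hm hf hmeas.enorm]
        refine lintegral_mono fun x => ?_
        rw [lintegral_comp_eval_gaussianDensity hT j (m x) measurable_enorm, enorm_mul,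
          Real.enorm_of_nonneg (hg0 x), ← mul_add]
        gcongr
        exact lintegral_enorm_gaussianReal_le _ _
    _ = (∫⁻ x, ENNReal.ofReal (g x)) * C + ∫⁻ x, ‖g x * m x j‖ₑ := by
        rw [lintegral_add_left (hg.ennreal_ofReal.mul_const _), lintegral_mul_const _
          hg.ennreal_ofReal]
    _ < ⊤ := ENNReal.add_lt_top.2 ⟨ENNReal.mul_lt_top hgi.lintegral_lt_top
        (lintegral_enorm_gaussianReal_lt_top _), hmi.2⟩

lemma integral_eval_jointLaw_gaussianMixture (hT : T.PosDef) (hg : Measurable g)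
    (hg0 : ∀ x, 0 ≤ g x) (hm : Continuous m)
    (hf : ∀ p, f p = g p.1 * gaussianDensity (m p.1) T p.2) (hgi : Integrable g) (j : Fin k)
    (hmi : Integrable fun x => g x * m x j) :
    ∫ p, p.2 j ∂jointLaw f = ∫ x, g x * m x j := by
  have hint := integrable_eval_jointLaw_gaussianMixture hT hg hg0 hm hf hgi j hmi
  have hfm := (measurable_gaussianMixture hg hm hf).ennreal_ofReal
  rw [jointLaw, integrable_withDensity_iff_integrable_smul' hfm (by simp)] at hint
  rw [jointLaw, integral_withDensity_eq_integral_toReal_smul hfm (by simp)]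
  refine (integral_prod _ hint).trans (integral_congr_ae (ae_of_all _ fun x => ?_))
  have hf0 : ∀ p, 0 ≤ f p := fun p => by
    rw [hf]
    exact mul_nonneg (hg0 _) (gaussianDensity_pos hT _ _).le
  simp only [ENNReal.toReal_ofReal (hf0 _), smul_eq_mul]
  simp only [hf, mul_assoc]
  rw [integral_const_mul, integral_gaussianDensity_mul_eval hT]

lemma marginalDensityY_eq (f : ℝ × (Fin k → ℝ) → ℝ) (i : Fin k) (s : ℝ) :
    marginalDensityY f i s =
      ∫ q : ℝ × ({j : Fin k // j ≠ i} → ℝ), f (q.1, glueCoord i (s, q.2)) :=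
  rfl

/-- By nonnegativity both sides come from lower integrals, where Tonelli applies even if `G` is not
integrable. -/
lemma integral_mul_gaussianDensity {ι : Type} [Fintype ι] [DecidableEq ι] {T : Matrix ι ι ℝ}
    (hT : T.PosDef) {c : ℝ → ι → ℝ} (hc : Continuous c) {G : ℝ → ℝ} (hG : Measurable G)
    (hG0 : ∀ x, 0 ≤ G x) :
    ∫ q : ℝ × (ι → ℝ), G q.1 * gaussianDensity (c q.1) T q.2 = ∫ x, G x := by
  have hq : Measurable fun q : ℝ × (ι → ℝ) => gaussianDensity (c q.1) T q.2 :=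
    (continuous_gaussianDensity (hc.comp continuous_fst) continuous_snd _).measurable
  have hprod : Measurable fun q : ℝ × (ι → ℝ) => G q.1 * gaussianDensity (c q.1) T q.2 :=
    (hG.comp measurable_fst).mul hq
  have hinner : ∀ x, ∫⁻ q, ENNReal.ofReal (G x * gaussianDensity (c x) T q) =
      ENNReal.ofReal (G x) := fun x => by
    have hqx : Measurable fun q => gaussianDensity (c x) T q :=
      (continuous_gaussianDensity continuous_const continuous_id T).measurable
    simp only [ENNReal.ofReal_mul (hG0 x)]
    rw [lintegral_const_mul _ hqx.ennreal_ofReal, lintegral_gaussianDensity hT, mul_one]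
  have hprod0 : ∀ q : ℝ × (ι → ℝ), 0 ≤ G q.1 * gaussianDensity (c q.1) T q.2 := fun q =>
    mul_nonneg (hG0 q.1) (gaussianDensity_pos hT _ _).le
  rw [integral_eq_lintegral_of_nonneg_ae (ae_of_all _ hprod0) hprod.aestronglyMeasurable,
    integral_eq_lintegral_of_nonneg_ae (ae_of_all _ hG0) hG.aestronglyMeasurable,
    Measure.volume_eq_prod, lintegral_prod _ hprod.ennreal_ofReal.aemeasurable]
  simp only [hinner]

lemma marginalDensityY_gaussianMixture (hT : T.PosDef) (hg : Measurable g) (hg0 : ∀ x, 0 ≤ g x)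
    (hm : Continuous m) (hf : ∀ p, f p = g p.1 * gaussianDensity (m p.1) T p.2) (i : Fin k)
    (s : ℝ) :
    marginalDensityY f i s = ∫ x, g x * gaussianPDFReal (m x i) (T i i).toNNReal s := by
  have hmi : ∀ j, Continuous fun x => m x j := fun j => (continuous_apply j).comp hm
  have hc : Continuous fun x => (fun j : {j : Fin k // j ≠ i} => m x j) +
      ((s - m x i) / T i i) • restCov T i := by
    refine continuous_pi fun j => ?_
    simp only [Pi.add_apply, Pi.smul_apply, smul_eq_mul]
    exact (hmi j).add (((continuous_const.sub (hmi i)).div_const _).mul continuous_const)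
  have hφ : Measurable fun x => g x * gaussianPDFReal (m x i) (T i i).toNNReal s := by
    refine hg.mul ?_
    unfold gaussianPDFReal
    have := (hmi i).measurable
    fun_prop
  rw [← integral_mul_gaussianDensity (posDef_scalarBlocks_splitCoord hT i).condCov hc hφ
    fun x => mul_nonneg (hg0 x) (gaussianPDFReal_nonneg _ _ _)]
  simp only [marginalDensityY_eq, hf, gaussianDensity_split hT, mul_assoc]

end GaussianMixture

/-! ### The posterior satisfies the view and minimizes the entropy. -/

section Posterior

variable {k : ℕ} {μx : ℝ} {μy : Fin k → ℝ} {σxx : ℝ} {σxy : Fin k → ℝ}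
  {Syy : Matrix (Fin k) (Fin k) ℝ} {g : ℝ → ℝ} {a : Fin k → ℝ}

lemma IsProbDensity.integrable (hg : IsProbDensity g) : Integrable g :=
  Integrable.of_integral_ne_zero (by rw [hg.integral_eq_one]; exact one_ne_zero)

lemma IsProbDensity.isProbabilityMeasure (hg : IsProbDensity g) :
    IsProbabilityMeasure (volume.withDensity fun x => ENNReal.ofReal (g x)) := by
  refine ⟨?_⟩
  rw [withDensity_apply _ MeasurableSet.univ, Measure.restrict_univ,
    ← ofReal_integral_eq_lintegral_ofReal hg.integrable (ae_of_all _ hg.nonneg),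
    hg.integral_eq_one, ENNReal.ofReal_one]

lemma isProbDensity_gaussianPDFReal (c : ℝ) {v : NNReal} (hv : v ≠ 0) :
    IsProbDensity (gaussianPDFReal c v) :=
  ⟨measurable_gaussianPDFReal c v, gaussianPDFReal_nonneg c v, integral_gaussianPDFReal_eq_one c hv⟩

lemma continuous_condMean (c : ℝ) :
    Continuous fun x : ℝ => a + ((x - c) / σxx) • σxy := by
  fun_prop

lemma priorDensity_eq (hS : (jointCov σxx σxy Syy).PosDef) (p : ℝ × (Fin k → ℝ)) :
    priorDensity μx μy σxx σxy Syy p = gaussianPDFReal μx σxx.toNNReal p.1 *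
      gaussianDensity (μy + ((p.1 - μx) / σxx) • σxy) (condCov σxx σxy Syy) p.2 :=
  gaussianDensity_scalarBlocks hS μx μy p.1 p.2

lemma posteriorDensity_eq (p : ℝ × (Fin k → ℝ)) :
    posteriorDensity g a σxx σxy Syy p = g p.1 *
      gaussianDensity (a + ((p.1 - meanOf g) / σxx) • σxy) (condCov σxx σxy Syy) p.2 :=
  rfl

lemma isProbabilityMeasure_jointLaw {m : ℝ → Fin k → ℝ} {T : Matrix (Fin k) (Fin k) ℝ}
    {f : ℝ × (Fin k → ℝ) → ℝ} (hT : T.PosDef) (hg : IsProbDensity g) (hm : Continuous m)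
    (hf : ∀ p, f p = g p.1 * gaussianDensity (m p.1) T p.2) :
    IsProbabilityMeasure (jointLaw f) := by
  refine ⟨?_⟩
  have h := hg.isProbabilityMeasure.measure_univ
  rw [← map_fst_jointLaw_gaussianMixture hT hg.measurable hg.nonneg hm hf,
    Measure.map_apply measurable_fst MeasurableSet.univ] at h
  exact h

lemma priorDensity_pos (hS : (jointCov σxx σxy Syy).PosDef) (p : ℝ × (Fin k → ℝ)) :
    0 < priorDensity μx μy σxx σxy Syy p :=
  gaussianDensity_pos hS _ _

lemma measurable_priorDensity : Measurable (priorDensity μx μy σxx σxy Syy) := by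
  refine (continuous_gaussianDensity continuous_const ?_ _).measurable
  refine continuous_pi fun j => ?_
  rcases j with j | j
  · exact continuous_fst
  · exact (continuous_apply j).comp continuous_snd

lemma measurable_posteriorDensity (hg : IsProbDensity g) :
    Measurable (posteriorDensity g a σxx σxy Syy) :=
  measurable_gaussianMixture hg.measurable (continuous_condMean (meanOf g)) posteriorDensity_eq

lemma jointLaw_eq_withDensity_div {f₀ f : ℝ × (Fin k → ℝ) → ℝ} (h₀ : Measurable f₀)
    (h : Measurable f) (hpos : ∀ p, 0 < f₀ p) :
    jointLaw f = (jointLaw f₀).withDensity fun p => ENNReal.ofReal (f p / f₀ p) := by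
  have hr : Measurable fun p => f p / f₀ p := h.div h₀
  rw [jointLaw, jointLaw, ← withDensity_mul _ h₀.ennreal_ofReal hr.ennreal_ofReal]
  congr 1
  ext p
  rw [Pi.mul_apply, ← ENNReal.ofReal_mul (hpos p).le, mul_div_cancel₀ _ (hpos p).ne']

theorem satisfiesView_posterior (hS : (jointCov σxx σxy Syy).PosDef) (hg : IsProbDensity g)
    (hg1 : Integrable fun x => x * g x) :
    SatisfiesView (jointLaw (priorDensity μx μy σxx σxy Syy)) g a
      (jointLaw (posteriorDensity g a σxx σxy Syy)) := by
  have hT : (condCov σxx σxy Syy).PosDef := Matrix.PosDef.condCov hS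
  have hm : Continuous fun x : ℝ => a + ((x - meanOf g) / σxx) • σxy := continuous_condMean _
  have hf := posteriorDensity_eq (g := g) (a := a) (σxx := σxx) (σxy := σxy) (Syy := Syy)
  have hcenter : ∀ j, (fun x => g x * (a + ((x - meanOf g) / σxx) • σxy) j) =
      fun x => (a j - meanOf g / σxx * σxy j) * g x + σxy j / σxx * (x * g x) := fun j => by
    ext x
    simp only [Pi.add_apply, Pi.smul_apply, smul_eq_mul]
    ring
  have hmi : ∀ j, Integrable fun x => g x * (a + ((x - meanOf g) / σxx) • σxy) j := fun j => by
    rw [hcenter]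
    exact (hg.integrable.const_mul _).add (hg1.const_mul _)
  refine ⟨isProbabilityMeasure_jointLaw hT hg hm hf, ?_,
    map_fst_jointLaw_gaussianMixture hT hg.measurable hg.nonneg hm hf,
    fun j => integrable_eval_jointLaw_gaussianMixture hT hg.measurable hg.nonneg hm hf
      hg.integrable j (hmi j), fun j => ?_⟩
  · rw [jointLaw_eq_withDensity_div measurable_priorDensity (measurable_posteriorDensity hg)
      (priorDensity_pos hS)]
    exact withDensity_absolutelyContinuous _ _
  · rw [integral_eval_jointLaw_gaussianMixture hT hg.measurable hg.nonneg hm hf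
      hg.integrable j (hmi j), hcenter, integral_add (hg.integrable.const_mul _)
      (hg1.const_mul _), integral_const_mul, integral_const_mul, hg.integral_eq_one]
    rw [show ∫ x, x * g x = meanOf g from rfl]
    ring

/-- Equal covariances make the normalizing constants and the terms quadratic in `y` cancel, leaving
an affine function of `y`. -/
lemma gaussianDensity_div {T : Matrix (Fin k) (Fin k) ℝ} (hT : T.PosDef) (m d y : Fin k → ℝ) :
    Real.log (gaussianDensity (m + d) T y / gaussianDensity m T y) =
      y ⬝ᵥ T⁻¹.mulVec d - m ⬝ᵥ T⁻¹.mulVec d - 1 / 2 * (d ⬝ᵥ T⁻¹.mulVec d) := by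
  have hsymm : d ⬝ᵥ T⁻¹.mulVec (y - m) = (y - m) ⬝ᵥ T⁻¹.mulVec d := by
    have h : T⁻¹.transpose = T⁻¹ := by simpa using hT.inv.1.eq
    rw [Matrix.dotProduct_mulVec, ← Matrix.mulVec_transpose, h, dotProduct_comm]
  have e := sub_dotProduct y m (T⁻¹.mulVec d)
  have hdet := hT.det_pos
  have hpi := Real.pi_pos
  unfold gaussianDensity
  rw [mul_div_mul_left _ _ (by positivity), ← Real.exp_sub, Real.log_exp, ← sub_sub,
    Matrix.mulVec_sub, sub_dotProduct, dotProduct_sub, dotProduct_sub, hsymm]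
  linear_combination e

theorem isOptimalPosterior (hS : (jointCov σxx σxy Syy).PosDef) (hg : IsProbDensity g)
    (hg1 : Integrable fun x => x * g x) :
    IsOptimalPosterior (jointLaw (priorDensity μx μy σxx σxy Syy)) g a
      (jointLaw (posteriorDensity g a σxx σxy Syy)) := by
  have hview := satisfiesView_posterior (μx := μx) (μy := μy) (a := a) hS hg hg1
  refine ⟨hview, fun ν hν => ?_⟩
  have hT : (condCov σxx σxy Syy).PosDef := Matrix.PosDef.condCov hS
  have hxx : 0 < σxx := Matrix.PosDef.scalarBlocks_pos hS
  have hv : σxx.toNNReal ≠ 0 := by simpa using hxx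
  have := hview.isProbabilityMeasure
  have := hν.isProbabilityMeasure
  have : IsProbabilityMeasure (jointLaw (priorDensity μx μy σxx σxy Syy)) :=
    isProbabilityMeasure_jointLaw hT (isProbDensity_gaussianPDFReal μx hv)
      (continuous_condMean μx) (priorDensity_eq hS)
  have hfm := measurable_priorDensity (μx := μx) (μy := μy) (σxx := σxx) (σxy := σxy) (Syy := Syy)
  have hpm := measurable_posteriorDensity (a := a) (σxx := σxx) (σxy := σxy) (Syy := Syy) hg
  have hpos := priorDensity_pos (μx := μx) (μy := μy) hS
  have hgm := hg.measurable
  -- The posterior conditional mean minus the prior one, the same at every `x`.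
  set d : Fin k → ℝ := a - μy + ((μx - meanOf g) / σxx) • σxy with hd
  set w : Fin k → ℝ := (condCov σxx σxy Syy)⁻¹.mulVec d
  have hmean : ∀ {ν'}, SatisfiesView (jointLaw (priorDensity μx μy σxx σxy Syy)) g a ν' →
      Integrable (fun p => p.2 ⬝ᵥ w) ν' ∧ ∫ p, p.2 ⬝ᵥ w ∂ν' = a ⬝ᵥ w := fun h => by
    simp only [dotProduct]
    refine ⟨integrable_finsetSum _ fun j _ => (h.integrable j).mul_const _, ?_⟩
    rw [integral_finsetSum _ fun j _ => (h.integrable j).mul_const _]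
    simp only [integral_mul_const, h.mean]
  have hgpos : ∀ᵐ p ∂ν, 0 < g p.1 := by
    refine ae_of_ae_map (p := fun x => 0 < g x) measurable_fst.aemeasurable ?_
    rw [hν.marginal, ae_withDensity_iff hgm.ennreal_ofReal]
    exact ae_of_all _ fun x hx => by simpa using hx
  -- `L` gathers the ratio of the `X`-densities and the `y`-free terms of the conditional ratio;
  -- only `y ⬝ᵥ w` remains for `A`.
  refine klDiv_withDensity_le (hpm.div hfm)
    (fun p => div_nonneg (mul_nonneg (hg.nonneg _) (gaussianDensity_pos hT _ _).le) (hpos p).le)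
    (jointLaw_eq_withDensity_div hfm hpm hpos) hν.absolutelyContinuous ?_ measurable_fst
    (L := fun x => Real.log (g x / gaussianPDFReal μx σxx.toNNReal x) -
      (μy + ((x - μx) / σxx) • σxy) ⬝ᵥ w - 1 / 2 * (d ⬝ᵥ w)) ?_
    (A := fun p => p.2 ⬝ᵥ w) ?_ (hmean hν).1 (hmean hview).1
    ((hmean hν).2.trans (hmean hview).2.symm) (hν.marginal.trans hview.marginal.symm)
  · filter_upwards [hgpos] with p hp
    exact div_pos (mul_pos hp (gaussianDensity_pos hT _ _)) (hpos p)
  · have h1 := measurable_gaussianPDFReal μx σxx.toNNReal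
    have h2 : Measurable fun x : ℝ => (μy + ((x - μx) / σxx) • σxy) ⬝ᵥ w :=
      ((continuous_condMean μx).dotProduct continuous_const).measurable
    fun_prop
  · intro p hp
    have hgp : 0 < g p.1 := by
      refine (hg.nonneg _).lt_of_ne fun h0 => ?_
      simp [posteriorDensity, ← h0] at hp
    have hφ := gaussianPDFReal_pos μx σxx.toNNReal p.1 hv
    have hm : a + ((p.1 - meanOf g) / σxx) • σxy = μy + ((p.1 - μx) / σxx) • σxy + d := by
      ext j
      simp only [hd, Pi.add_apply, Pi.sub_apply, Pi.smul_apply, smul_eq_mul]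
      ring
    have hr : posteriorDensity g a σxx σxy Syy p / priorDensity μx μy σxx σxy Syy p =
        g p.1 / gaussianPDFReal μx σxx.toNNReal p.1 *
          (gaussianDensity (μy + ((p.1 - μx) / σxx) • σxy + d) (condCov σxx σxy Syy) p.2 /
            gaussianDensity (μy + ((p.1 - μx) / σxx) • σxy) (condCov σxx σxy Syy) p.2) := by
      rw [priorDensity_eq hS, posteriorDensity, hm, mul_div_mul_comm]
    rw [Pi.div_apply, hr, Real.log_mul (div_pos hgp hφ).ne'
      (div_pos (gaussianDensity_pos hT _ _) (gaussianDensity_pos hT _ _)).ne',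
      gaussianDensity_div hT]
    ring

end Posterior

/-! ### Tails of the marginals of the posterior. -/

section Tail

variable {k : ℕ} {σxx : ℝ} {σxy : Fin k → ℝ} {Syy : Matrix (Fin k) (Fin k) ℝ} {g : ℝ → ℝ}
  {a : Fin k → ℝ} {α : ℝ}

lemma marginalDensityY_posterior (hS : (jointCov σxx σxy Syy).PosDef) (hg : IsProbDensity g)
    (i : Fin k) (s : ℝ) :
    marginalDensityY (posteriorDensity g a σxx σxy Syy) i s =
      ∫ x, g x * gaussianPDFReal (a i - meanOf g * (σxy i / σxx) + x * (σxy i / σxx))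
        (condCov σxx σxy Syy i i).toNNReal s := by
  rw [marginalDensityY_gaussianMixture (Matrix.PosDef.condCov hS) hg.measurable hg.nonneg
    (continuous_condMean (meanOf g)) posteriorDensity_eq]
  congr! 4 with x
  simp only [Pi.add_apply, Pi.smul_apply, smul_eq_mul]
  ring

lemma gaussianPDFReal_neg_neg (c : ℝ) (v : NNReal) (s : ℝ) :
    gaussianPDFReal (-c) v (-s) = gaussianPDFReal c v s := by
  rw [gaussianPDFReal, gaussianPDFReal, show -s - -c = -(s - c) by ring, neg_sq]

theorem tendsto_marginalDensityY_of_pos (hS : (jointCov σxx σxy Syy).PosDef)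
    (hg : IsProbDensity g) (hα : FatTailed g α) {i : Fin k} (hi : 0 < σxy i) :
    Tendsto (fun s => marginalDensityY (posteriorDensity g a σxx σxy Syy) i s / g s) atTop
      (𝓝 ((σxy i / σxx) ^ (α - 1))) := by
  simp only [marginalDensityY_posterior hS hg]
  exact hα.tendsto_gaussian_mixture_div hg
    ((Matrix.PosDef.condCov hS).toNNReal_diag_ne_zero i)
    (div_pos hi (Matrix.PosDef.scalarBlocks_pos hS)) _

theorem tendsto_marginalDensityY_of_neg (hS : (jointCov σxx σxy Syy).PosDef)
    (hg : IsProbDensity g) (hα : FatTailed g α) {i : Fin k} (hi : σxy i < 0) :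
    Tendsto (fun s => marginalDensityY (posteriorDensity g a σxx σxy Syy) i (-s) / g s) atTop
      (𝓝 ((|σxy i| / σxx) ^ (α - 1))) := by
  simp only [marginalDensityY_posterior hS hg]
  -- The mixture for `-Y_i`, which has positive slope `|σxy i| / σxx` and the opposite intercept.
  have h := hα.tendsto_gaussian_mixture_div hg
    ((Matrix.PosDef.condCov hS).toNNReal_diag_ne_zero i)
    (div_pos (abs_pos.2 hi.ne) (Matrix.PosDef.scalarBlocks_pos hS))
    (-(a i - meanOf g * (σxy i / σxx)))
  refine h.congr fun s => ?_
  congr! 4 with x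
  rw [← gaussianPDFReal_neg_neg, abs_of_neg hi]
  congr 1
  ring

theorem tendsto_marginalDensityY_of_even (hS : (jointCov σxx σxy Syy).PosDef)
    (hg : IsProbDensity g) (hα : FatTailed g α) (heven : ∀ x, g (-x) = g x) {i : Fin k}
    (hi : σxy i ≠ 0) :
    Tendsto (fun s => marginalDensityY (posteriorDensity g a σxx σxy Syy) i s / g s) atTop
      (𝓝 ((|σxy i| / σxx) ^ (α - 1))) := by
  rcases hi.lt_or_gt with hi | hi
  · simp only [marginalDensityY_posterior hS hg]
    have h := hα.tendsto_gaussian_mixture_div hg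
      ((Matrix.PosDef.condCov hS).toNNReal_diag_ne_zero i)
      (div_pos (abs_pos.2 hi.ne) (Matrix.PosDef.scalarBlocks_pos hS))
      (a i - meanOf g * (σxy i / σxx))
    refine h.congr fun s => ?_
    -- The reflection `x ↦ -x` preserves the even `g` and reverses the sign of the slope, leaving
    -- the intercept unchanged.
    rw [← integral_neg_eq_self fun x => g x * gaussianPDFReal _ _ _]
    simp only [heven, abs_of_neg hi]
    congr! 4 with x
    ring_nf
  · rw [abs_of_pos hi]
    exact tendsto_marginalDensityY_of_pos hS hg hα hi

end Tail

theorem mainTheorem3 {k : ℕ} (μx : ℝ) (μy : Fin k → ℝ) (σxx : ℝ) (σxy : Fin k → ℝ)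
    (Syy : Matrix (Fin k) (Fin k) ℝ) (hS : (jointCov σxx σxy Syy).PosDef)
    (g : ℝ → ℝ) (hg : IsProbDensity g) (hg1 : Integrable (fun x => x * g x))
    (a : Fin k → ℝ) (α : ℝ) (hα : FatTailed g α) :
    IsOptimalPosterior (jointLaw (priorDensity μx μy σxx σxy Syy)) g a
        (jointLaw (posteriorDensity g a σxx σxy Syy)) ∧
      ∀ i : Fin k,
        (0 < σxy i →
          Tendsto (fun s => marginalDensityY (posteriorDensity g a σxx σxy Syy) i s / g s)
            atTop (𝓝 ((σxy i / σxx) ^ (α - 1)))) ∧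
        (σxy i < 0 →
          Tendsto (fun s => marginalDensityY (posteriorDensity g a σxx σxy Syy) i (-s) / g s)
            atTop (𝓝 ((|σxy i| / σxx) ^ (α - 1)))) ∧
        (σxy i ≠ 0 → (∀ x, g (-x) = g x) →
          Tendsto (fun s => marginalDensityY (posteriorDensity g a σxx σxy Syy) i s / g s)
            atTop (𝓝 ((|σxy i| / σxx) ^ (α - 1)))) :=
  ⟨isOptimalPosterior hS hg hg1, fun _ => ⟨tendsto_marginalDensityY_of_pos hS hg hα,
    tendsto_marginalDensityY_of_neg hS hg hα,
    fun hi heven => tendsto_marginalDensityY_of_even hS hg hα heven hi⟩⟩
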